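/- Let $q$ be a power of a prime $p$, and let $k$ be a positive multiple of $q-1$. For $d\ge 1$ put $$P_d(k)=\sum_{\deg\wp=d}\frac1{1-\wp^k},\qquad P_{\le d}(k)=\sum_{\deg\wp\le d}\frac1{1-\wp^k}\in\mathbb F_q(t),$$ where $\wp$ runs through the monic irreducible polynomials in $\mathbb F_q[t]$ (of positive degree). Let $p_d(k)$ and $p_{\le d}(k)$ be the valuations of $P_d(k)$ and $P_{\le d}(k)$ at infinity, i.e. minus the degree in $t$, with the valuation of $0$ being $+\infty$; $+\infty$ is regarded as divisible by every positive integer. Let $[1]=t^q-t$. Then for every $d\ge1$: (0) $P_d(k)\in\mathbb F_p(t^{q-1})$, and $P_d(k)$ is also a ratio of two polynomials in $[1]$ with coefficients in $\mathbb F_p$. (i) $p_d(k)$ is divisible by $q(q-1)$ and $p_d(k)\ge kd$. Moreover, $p_{\le d}(k)$ is divisible by $q(q-1)$. (ii) $p_d(k)=kd$ if and only if either (I) $q$ is a prime and $d$ is a squarefree multiple of $q$, or (II) $q=2$ and $d=4m$ with $m$ a squarefree odd natural number. (iii) Let $q=2$ and let $k$ be odd. In the expansion of $P_d(k)$ as a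 Laurent series in $1/t$, the coefficient of $t^{-(dk+1)}$ is nonzero if and only if $d$ is squarefree. Hence $p_d(k)=dk+1$ if $d$ is odd and squarefree, $p_d(k)=dk$ if $d$ is even and squarefree or $4$ times an odd squarefree number, and $p_d(k)>dk+1$ in all other cases. -/

import Mathlib

open Polynomial
open scoped LaurentSeries IntermediateField

noncomputable section

namespace PrimeSums

variable (F : Type*) [Field F]

theorem finite_natDegree_le [Fintype F] (d : ℕ) : {f : F[X] | f.natDegree ≤ d}.Finite := by
  have h : {f : F[X] | f.natDegree ≤ d} ⊆
      Set.range (fun c : Fin (d + 1) → F => ∑ i : Fin (d + 1), C (c i) * X ^ (i : ℕ)) := by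
    intro f hf
    refine ⟨fun i => f.coeff i, ?_⟩
    have hf' : f.natDegree < d + 1 := Nat.lt_succ_of_le hf
    conv_rhs => rw [f.as_sum_range' (d + 1) hf']
    simp [Finset.sum_range, C_mul_X_pow_eq_monomial]
  exact (Set.finite_range _).subset h

theorem finite_primesLE [Fintype F] (d : ℕ) :
    {w : F[X] | w.Monic ∧ Irreducible w ∧ w.natDegree ≤ d}.Finite :=
  (finite_natDegree_le F d).subset fun _ h => h.2.2

theorem finite_primesEq [Fintype F] (d : ℕ) :
    {w : F[X] | w.Monic ∧ Irreducible w ∧ w.natDegree = d}.Finite :=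
  (finite_natDegree_le F d).subset fun _ h => h.2.2.le

/-- The monic irreducible polynomials of degree `d` in `F[t]`. -/
def primesEq [Fintype F] (d : ℕ) : Finset F[X] := (finite_primesEq F d).toFinset

/-- The monic irreducible polynomials of degree at most `d` in `F[t]`. -/
def primesLE [Fintype F] (d : ℕ) : Finset F[X] := (finite_primesLE F d).toFinset

/-- `P_d(k)`: the sum of `1 / (1 - w ^ k)` over the monic irreducible `w` of degree `d`. -/
def PEq [Fintype F] (d k : ℕ) : RatFunc F :=
  ∑ w ∈ primesEq F d, 1 / (1 - algebraMap F[X] (RatFunc F) w ^ k)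

/-- `P_{≤ d}(k)`: the sum of `1 / (1 - w ^ k)` over the monic irreducible `w` of degree
at most `d`. -/
def PLE [Fintype F] (d k : ℕ) : RatFunc F :=
  ∑ w ∈ primesLE F d, 1 / (1 - algebraMap F[X] (RatFunc F) w ^ k)

variable {F}

/-- The (additive) valuation of `F(t)` at infinity: minus the degree in `t`, and `⊤` at `0`. -/
def vInfty (f : RatFunc F) : WithTop ℤ :=
  open Classical in if f = 0 then ⊤ else ((-f.intDegree : ℤ) : WithTop ℤ)

/-- `[n] = t ^ (q ^ n) - t` in `F(t)`. -/
def bracket (F : Type*) [Field F] [Fintype F] (n : ℕ) : RatFunc F :=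
  RatFunc.X ^ (Fintype.card F ^ n) - RatFunc.X

variable (F)

/-- The substitution of the inverse `s⁻¹` of the variable `s` of `F((s))` into polynomials. -/
def polyAtInfty : F[X] →+* F⸨X⸩ :=
  Polynomial.eval₂RingHom (HahnSeries.C : F →+* F⸨X⸩) (HahnSeries.single (-1 : ℤ) (1 : F))

theorem coeff_polyAtInfty (f : F[X]) (n : ℕ) :
    (polyAtInfty F f).coeff (-(n : ℤ)) = f.coeff n := by
  induction f using Polynomial.induction_on' with
  | add f g hf hg => simp [map_add, hf, hg]
  | monomial m a =>
    simp only [polyAtInfty, coe_eval₂RingHom, eval₂_monomial, HahnSeries.single_pow, one_pow,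
      HahnSeries.C_apply, HahnSeries.single_mul_single, zero_add, mul_one, coeff_monomial,
      HahnSeries.coeff_single]
    simp [eq_comm]

theorem polyAtInfty_injective : Function.Injective (polyAtInfty F) := by
  intro f g h
  ext n
  rw [← coeff_polyAtInfty, h, coeff_polyAtInfty]

/-- The embedding of `F(t)` into its completion `F((1/t))` at infinity, which is written as the
field of Laurent series in a variable `s = 1/t`: the field homomorphism with `t ↦ s⁻¹`. -/
def expandInfty : RatFunc F →+* F⸨X⸩ :=
  IsFractionRing.lift (A := F[X]) (polyAtInfty_injective F)

theorem expandInfty_X :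
    expandInfty F RatFunc.X = HahnSeries.single (-1 : ℤ) (1 : F) := by
  rw [← RatFunc.algebraMap_X, expandInfty, IsFractionRing.lift_algebraMap]
  simp [polyAtInfty]

theorem expandInfty_C (a : F) : expandInfty F (RatFunc.C a) = HahnSeries.C a := by
  rw [← RatFunc.algebraMap_C, expandInfty, IsFractionRing.lift_algebraMap]
  simp [polyAtInfty]

variable {F}

/-- The coefficient of `t ^ n` in the expansion of `f ∈ F(t)` as a Laurent series in `1/t`. -/
def coeffInfty (f : RatFunc F) (n : ℤ) : F := (expandInfty F f).coeff (-n)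

end PrimeSums

end

/-! ### Valuations of Möbius sums, and the equations for exponents that they lead to. -/

section Arithmetic

open ArithmeticFunction
open UniqueFactorizationMonoid hiding moebius

/-! Two independent arguments are combined.

Symmetry gives (0) and the divisibilities in (i). With `G(Y) = ∏ (Y - w ^ k)` over the primes in
question, the sum is the logarithmic derivative `G'(1) / G(1)`. A degree-preserving ring
automorphism of `F[t]` permutes these primes up to constants, and the constants die in `w ^ k`
because `q - 1 ∣ k` (`map_powPoly`). So `G'(1)` and `G(1)` are fixed by `t ↦ t + a`, by `t ↦ c t`
and by Frobenius on coefficients, which makes them polynomials over the prime field in `[1] ^ (q -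
1)` (`exists_aeval_polyBracket_pow_eq`). This element has degree `q (q - 1)` and lies in the field
generated by `t ^ (q - 1)`.

Expansion at infinity and counting give the rest. With `s = 1 / t`, each `1 / (1 - w ^ k)` is `-s ^
(d k)` times a power series `1 - k c s + ...`, where `c` is the subleading coefficient of `w` (for
`d k = 1` there is one more `s`). Hence `p_d(k) ≥ k d`, with equality exactly when `p` does not
divide the number of primes of degree `d`. For `q = 2` and `k` odd, the next coefficient is the
parity of the number of primes with `c ≠ 0`.

Both counts are governed by Möbius formulas: the first comes from counting the elements of the
extension of degree `d`, the second from counting those of nonzero trace. In such a sum of signed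
powers of `p` the exponent is smallest at the single term indexed by `d / radical d` (by `n /
radical n`, with `n` the odd part of `d`, for the second count), so the `p`-adic valuation is known
exactly and the criteria become equations between exponents. -/

theorem sum_moebius_mul_pow_eq (p : ℕ) (u : ℕ → ℕ) {n : ℕ} (hn : n ≠ 0)
    (hu : ∀ l, n / radical n < l → u (n / radical n) < u l) :
    ∃ ε t : ℤ, (ε = 1 ∨ ε = -1) ∧
      ∑ x ∈ n.divisorsAntidiagonal, moebius x.1 * (p : ℤ) ^ u x.2 =
        (p : ℤ) ^ u (n / radical n) * (ε + p * t) := by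
  have hr : radical n * (n / radical n) = n := Nat.mul_div_cancel' radical_dvd_self
  have hmem : (radical n, n / radical n) ∈ n.divisorsAntidiagonal :=
    Nat.mem_divisorsAntidiagonal.2 ⟨hr, hn⟩
  -- Only squarefree `x.1` contribute, and these divide `radical n`. The erased pair therefore has
  -- the least `x.2`, and each remaining term gains a factor `p`.
  have hdvd : (p : ℤ) ^ (u (n / radical n) + 1) ∣
      ∑ x ∈ n.divisorsAntidiagonal.erase (radical n, n / radical n),
        moebius x.1 * (p : ℤ) ^ u x.2 := by
    refine Finset.dvd_sum fun x hx => ?_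
    obtain ⟨hne, hx⟩ := Finset.mem_erase.1 hx
    obtain ⟨hx, -⟩ := Nat.mem_divisorsAntidiagonal.1 hx
    by_cases hs : Squarefree x.1
    · refine Dvd.dvd.mul_left (pow_dvd_pow _ (hu _ ?_)) _
      have h1 : x.1 ∣ radical n :=
        (dvd_radical_iff hs.isRadical hn).2 ⟨x.2, hx.symm⟩
      have h2 : x.1 ≤ radical n := Nat.le_of_dvd (Nat.radical_pos n) h1
      have h3 : x.1 ≠ radical n := by
        intro h
        apply hne
        ext
        · exact h
        · refine (Nat.div_eq_of_eq_mul_right (Nat.radical_pos n) ?_).symm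
          rw [← h, hx]
      have h4 : 0 < n / radical n := Nat.pos_of_ne_zero (by rintro h0; simp [h0] at hr; exact hn hr.symm)
      by_contra! hc
      have : x.1 * x.2 < radical n * (n / radical n) :=
        Nat.mul_lt_mul_of_lt_of_le (lt_of_le_of_ne h2 h3) hc h4
      omega
    · simp [moebius_eq_zero_of_not_squarefree hs]
  obtain ⟨t, ht⟩ := hdvd
  refine ⟨moebius (radical n), t, moebius_ne_zero_iff_eq_or.1
    (moebius_ne_zero_iff_squarefree.2 squarefree_radical), ?_⟩
  rw [← Finset.add_sum_erase _ _ hmem, ht]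
  ring

/-- The right side has `p`-adic valuation exactly `u (n / radical n)`, so that of `N` is what
remains after removing that of `d`. Keeping `u` and `n` general serves both counts. -/
theorem not_dvd_iff_of_mul_eq_sum_moebius {p : ℕ} (hp : p.Prime) (u : ℕ → ℕ) {n : ℕ} (hn : n ≠ 0)
    (hu : ∀ l, n / radical n < l → u (n / radical n) < u l) {d N : ℕ} (hd : d ≠ 0)
    (h : (d : ℤ) * N = ∑ x ∈ n.divisorsAntidiagonal, moebius x.1 * (p : ℤ) ^ u x.2) :
    ¬ p ∣ N ↔ padicValNat p d = u (n / radical n) := by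
  have := Fact.mk hp
  obtain ⟨ε, t, hε, ht⟩ := sum_moebius_mul_pow_eq p u hn hu
  rw [ht] at h
  have hw : ¬ (p : ℤ) ∣ ε + p * t := by
    intro hc
    have : (p : ℤ) ∣ ε := (Int.dvd_add_left ⟨t, rfl⟩).1 hc
    have h1 : (p : ℤ) ∣ 1 := by
      rcases hε with rfl | rfl
      · exact this
      · simpa using this
    exact hp.one_lt.ne' (by simpa using Int.natAbs_dvd_natAbs.2 h1)
  have hW : ¬ p ∣ (ε + p * t).natAbs := fun hc => hw (Int.natCast_dvd.2 hc)
  have hW0 : (ε + p * t).natAbs ≠ 0 := fun h0 => hW (h0 ▸ dvd_zero p)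
  have h' : d * N = p ^ u (n / radical n) * (ε + p * t).natAbs := by
    have := congrArg Int.natAbs h
    simpa [Int.natAbs_mul, Int.natAbs_pow] using this
  have hN : N ≠ 0 := by
    rintro rfl
    simp only [mul_zero] at h'
    exact (mul_ne_zero (pow_ne_zero _ hp.ne_zero) hW0) h'.symm
  have hv := congrArg (padicValNat p) h'
  rw [padicValNat.mul hd hN, padicValNat.mul (pow_ne_zero _ hp.ne_zero) hW0,
    padicValNat.prime_pow, padicValNat.eq_zero_of_not_dvd hW] at hv
  have : p ∣ N ↔ padicValNat p N ≠ 0 := dvd_iff_padicValNat_ne_zero hN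
  rw [this]
  omega

theorem div_radical_eq_one_iff {n : ℕ} (hn : n ≠ 0) : n / radical n = 1 ↔ Squarefree n := by
  have hr : radical n * (n / radical n) = n := Nat.mul_div_cancel' radical_dvd_self
  constructor
  · intro h
    rw [h, mul_one] at hr
    rw [← hr]
    exact squarefree_radical
  · intro h
    have h1 : n ∣ radical n := (dvd_radical_iff h.isRadical hn).2 dvd_rfl
    rw [Nat.dvd_antisymm radical_dvd_self h1]
    exact Nat.div_self (Nat.pos_of_ne_zero hn)

theorem padicValNat_le_one_of_squarefree {p n : ℕ} (hp : p.Prime) (hn : Squarefree n) :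
    padicValNat p n ≤ 1 := by
  rw [← Nat.factorization_def n hp]
  exact hn.natFactorization_le_one p

theorem radical_four_mul {m : ℕ} (hm : Odd m) (hs : Squarefree m) :
    radical (4 * m) = 2 * m := by
  have h4 : radical (4 : ℕ) = 2 := by
    rw [show (4 : ℕ) = 2 ^ 2 by norm_num, radical_pow_of_prime Nat.prime_two.prime two_ne_zero]
    simp
  have hc : Nat.Coprime 4 m := by
    rw [show (4 : ℕ) = 2 ^ 2 by norm_num]
    exact Nat.Coprime.pow_left _ (Nat.coprime_two_left.2 hm)
  rw [radical_mul (Nat.coprime_iff_isRelPrime.1 hc), h4]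
  congr 1
  exact Nat.dvd_antisymm radical_dvd_self
    ((dvd_radical_iff hs.isRadical hm.pos.ne').2 dvd_rfl)

/-- Let `a` be the valuation and `s = d / radical d`. The radical absorbs at most one factor `p`, so
`a ≤ 2 ^ (a - 1) ≤ p ^ (a - 1) ≤ s ≤ e * s = a`. Equality throughout forces `e = 1` and `a ≤ 2`,
with `p = 2` when `a = 2`. -/
theorem padicValNat_eq_mul_div_radical_iff {p e d : ℕ} (hp : p.Prime) (he : 0 < e) (hd : d ≠ 0) :
    padicValNat p d = e * (d / radical d) ↔
      ((p ^ e).Prime ∧ Squarefree d ∧ p ^ e ∣ d) ∨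
        (p ^ e = 2 ∧ ∃ m : ℕ, Odd m ∧ Squarefree m ∧ d = 4 * m) := by
  have := Fact.mk hp
  have hr : radical d * (d / radical d) = d := Nat.mul_div_cancel' radical_dvd_self
  set s := d / radical d with hs
  have hs0 : s ≠ 0 := by rintro h0; rw [h0, mul_zero] at hr; exact hd hr.symm
  constructor
  · intro h
    have hv : padicValNat p (radical d) + padicValNat p s = padicValNat p d := by
      rw [← padicValNat.mul (Nat.radical_pos d).ne' hs0, hr]
    have hv1 := padicValNat_le_one_of_squarefree hp (squarefree_radical (a := d))
    set a := padicValNat p d with ha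
    have ha1 : 1 ≤ a := by rw [h]; exact Nat.mul_pos he (Nat.pos_of_ne_zero hs0)
    have hps : p ^ (a - 1) ≤ s :=
      Nat.le_of_dvd (Nat.pos_of_ne_zero hs0)
        ((pow_dvd_pow p (by omega)).trans (pow_padicValNat_dvd (p := p) (n := s)))
    have h2p : 2 ^ (a - 1) ≤ p ^ (a - 1) := Nat.pow_le_pow_left hp.two_le _
    have ha2 : a ≤ 2 ^ (a - 1) := by
      have := Nat.lt_two_pow_self (n := a - 1)
      omega
    have hsa : s ≤ a := by rw [h]; exact Nat.le_mul_of_pos_left _ he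
    have hsa' : s = a := by omega
    have he1 : e = 1 := by
      rw [hsa'] at h
      exact Nat.eq_of_mul_eq_mul_right ha1 (by omega)
    have hpd : p ∣ d := dvd_of_one_le_padicValNat ha1
    subst he1
    rw [pow_one]
    have ha3 : a ≤ 2 := by
      by_contra! hc
      obtain ⟨b, hb⟩ := Nat.exists_eq_add_of_lt hc
      have h3 : 2 ^ (a - 1) = 4 * 2 ^ b := by rw [hb, show 2 + b + 1 - 1 = 2 + b by omega, pow_add]; norm_num
      have := Nat.lt_two_pow_self (n := b)
      omega
    obtain h1 | h2 : a = 1 ∨ a = 2 := by omega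
    · left
      exact ⟨hp, (div_radical_eq_one_iff hd).1 (by omega), hpd⟩
    · right
      have hp2 : p = 2 := by
        have : p ^ (a - 1) = 2 := by
          have : 2 ^ (a - 1) = 2 := by rw [h2]; norm_num
          omega
        simpa [h2] using this
      subst hp2
      refine ⟨rfl, ?_⟩
      have h2r : 2 ∣ radical d :=
        (dvd_radical_iff (Nat.prime_two.prime.squarefree).isRadical hd).2 hpd
      obtain ⟨m, hm⟩ := h2r
      have hsq : Squarefree (2 * m) := hm ▸ squarefree_radical
      refine ⟨m, ?_, hsq.squarefree_of_dvd (dvd_mul_left _ _), ?_⟩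
      · rw [← Nat.not_even_iff_odd]
        rintro hev
        obtain ⟨c, rfl⟩ := hev.two_dvd
        have := hsq 2 ⟨c, by ring⟩
        simp at this
      · rw [← hr, hm, hsa', h2]; ring
  · rintro (⟨hq, hsq, hqd⟩ | ⟨hq, m, hm, hsq, rfl⟩)
    · have he1 : e = 1 := (Nat.Prime.eq_one_of_pow hq)
      subst he1
      rw [pow_one] at hqd
      have h1 := padicValNat_le_one_of_squarefree hp hsq
      have h2 := one_le_padicValNat_of_dvd hd hqd
      have h3 := (div_radical_eq_one_iff hd).2 hsq
      rw [← hs] at h3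
      omega
    · have he1 : e = 1 := Nat.Prime.eq_one_of_pow (hq ▸ Nat.prime_two)
      subst he1
      rw [pow_one] at hq
      subst hq
      have h2 : s = 2 := by
        rw [hs, radical_four_mul hm hsq]
        have := hm.pos
        exact Nat.div_eq_of_eq_mul_left (by omega) (by ring)
      rw [h2, show 4 * m = 2 ^ 2 * m by ring,
        padicValNat.mul (by norm_num) hm.pos.ne', padicValNat.prime_pow,
        padicValNat.eq_zero_of_not_dvd hm.not_two_dvd_nat]

/-- Since `a < 2 ^ a`, the equation forces `n / radical n = 1`; then `a + 1 = 2 ^ a` leaves only `a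
= 0` and `a = 1`. -/
theorem squarefree_two_pow_mul_iff {a n : ℕ} (hn : Odd n) :
    a = 2 ^ a * (n / radical n) - 1 ↔ Squarefree (2 ^ a * n) := by
  have hn0 : n ≠ 0 := hn.pos.ne'
  have hr : radical n * (n / radical n) = n := Nat.mul_div_cancel' radical_dvd_self
  have hs0 : 0 < n / radical n :=
    Nat.pos_of_ne_zero (by rintro h0; rw [h0, mul_zero] at hr; exact hn0 hr.symm)
  have hcop : (2 ^ a).Coprime n := Nat.Coprime.pow_left _ (Nat.coprime_two_left.2 hn)
  have hlt := Nat.lt_two_pow_self (n := a)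
  rw [Nat.squarefree_mul_iff, and_iff_right hcop, ← div_radical_eq_one_iff hn0]
  constructor
  · intro h
    have hs1 : n / radical n = 1 := by
      by_contra hc
      have h2 : 2 ^ a * 2 ≤ 2 ^ a * (n / radical n) := Nat.mul_le_mul_left _ (by omega)
      omega
    refine ⟨?_, hs1⟩
    rw [hs1, mul_one] at h
    obtain rfl | rfl | ha : a = 0 ∨ a = 1 ∨ 2 ≤ a := by omega
    · simp
    · simpa using Nat.prime_two.prime.squarefree
    · obtain ⟨b, rfl⟩ := Nat.exists_eq_add_of_le ha
      have := Nat.lt_two_pow_self (n := b)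
      rw [pow_add] at h
      omega
  · rintro ⟨h1, h2⟩
    rw [h2, mul_one]
    have h3 := padicValNat_le_one_of_squarefree Nat.prime_two h1
    rw [padicValNat.prime_pow] at h3
    interval_cases a <;> simp

end Arithmetic

noncomputable section

namespace PrimeSums

/-! ### Counting primes, and primes with nonzero subleading coefficient. -/

section Counting

open UniqueFactorizationMonoid (radical)

variable (F : Type*) [Field F] [Fintype F]

theorem mem_primesEq {d : ℕ} {w : F[X]} :
    w ∈ primesEq F d ↔ w.Monic ∧ Irreducible w ∧ w.natDegree = d := by
  simp [primesEq]

theorem mem_primesLE {d : ℕ} {w : F[X]} :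
    w ∈ primesLE F d ↔ w.Monic ∧ Irreducible w ∧ w.natDegree ≤ d := by
  simp [primesLE]

variable (L : Type*) [Field L] [Fintype L] [Algebra F L]

open Classical in
-- The degree condition makes `w` divide `X ^ |L| - X`, so `w` splits in `L`; it is separable
-- because a finite field is perfect.
theorem card_filter_minpoly_eq {w : F[X]} (hm : w.Monic) (hi : Irreducible w)
    (hd : w.natDegree ∣ Module.finrank F L) :
    (Finset.univ.filter fun x : L => minpoly F x = w).card = w.natDegree := by
  have hsplit : Splits (w.map (algebraMap F L)) := by
    have h1 : w ∣ X ^ Fintype.card L - X := by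
      rw [Module.card_eq_pow_finrank (K := F) (V := L), Fintype.card_eq_nat_card]
      exact hi.natDegree_dvd_iff_dvd_X_pow_card_pow_sub_X.1 hd
    have h2 := (FiniteField.isSplittingField_sub L F).splits
    refine Splits.of_dvd h2 ?_ (map_dvd (algebraMap F L) h1)
    exact (Polynomial.map_ne_zero_iff (algebraMap F L).injective).2
      (FiniteField.X_pow_card_sub_X_ne_zero F Fintype.one_lt_card)
  rw [← card_rootSet_eq_natDegree (PerfectField.separable_of_irreducible hi) hsplit,
    ← Set.toFinset_card]
  congr 1
  ext x
  simp only [Finset.mem_filter, Finset.mem_univ, true_and, Set.mem_toFinset,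
    mem_rootSet_of_ne hi.ne_zero]
  constructor
  · rintro rfl
    exact minpoly.aeval F x
  · intro h
    exact (minpoly.eq_of_irreducible_of_monic hi h hm).symm

open Classical in
-- Elements of `L` are sorted by minimal polynomial. The predicate `Q` is left free so that one
-- count covers all elements and those of nonzero trace.
theorem card_filter_minpoly (Q : F[X] → Prop) [DecidablePred Q] :
    (Finset.univ.filter fun x : L => Q (minpoly F x)).card =
      ∑ e ∈ (Module.finrank F L).divisors, e * ((primesEq F e).filter Q).card := by
  have hint : ∀ x : L, IsIntegral F x := fun x => Algebra.IsIntegral.isIntegral x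
  have hL : Module.finrank F L ≠ 0 := Module.finrank_pos.ne'
  rw [Finset.card_eq_sum_card_fiberwise (f := fun x => (minpoly F x).natDegree)
    (t := (Module.finrank F L).divisors)]
  · refine Finset.sum_congr rfl fun e he => ?_
    rw [Finset.card_eq_sum_card_fiberwise (f := fun x => minpoly F x)
      (t := (primesEq F e).filter Q)]
    · rw [mul_comm, ← smul_eq_mul, ← Finset.sum_const]
      refine Finset.sum_congr rfl fun w hw => ?_
      rw [Finset.mem_filter, mem_primesEq] at hw
      obtain ⟨⟨hm, hi, hwe⟩, hQ⟩ := hw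
      have hcard := card_filter_minpoly_eq F L hm hi (hwe ▸ Nat.dvd_of_mem_divisors he)
      rw [hwe] at hcard
      refine Eq.trans (congrArg Finset.card ?_) hcard
      ext x
      simp only [Finset.mem_filter, Finset.mem_univ, true_and]
      constructor
      · exact fun h => h.2
      · rintro rfl
        exact ⟨⟨hQ, hwe⟩, rfl⟩
    · intro x hx
      simp only [Finset.coe_filter, Finset.mem_filter, Finset.mem_univ, true_and,
        Set.mem_ofPred_eq, mem_primesEq] at hx ⊢
      exact ⟨⟨minpoly.monic (hint x), minpoly.irreducible (hint x), hx.2⟩, hx.1⟩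
  · intro x _
    simp only [Finset.mem_coe, Nat.mem_divisors]
    exact ⟨minpoly.degree_dvd (hint x), hL⟩

theorem exists_extension_finrank_eq {d : ℕ} (hd : 0 < d) :
    ∃ (L : Type) (_ : Field L) (_ : Fintype L) (_ : Algebra F L), Module.finrank F L = d := by
  obtain ⟨p, hp⟩ := CharP.exists F
  have : Fact p.Prime := ⟨CharP.char_is_prime F p⟩
  have : NeZero d := ⟨hd.ne'⟩
  exact ⟨FiniteField.Extension F p d, inferInstance, Fintype.ofFinite _, inferInstance,
    FiniteField.finrank_extension F p d⟩

theorem card_pow_eq_sum_mul_card_primesEq {d : ℕ} (hd : 0 < d) :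
    Fintype.card F ^ d = ∑ e ∈ d.divisors, e * (primesEq F e).card := by
  obtain ⟨L, _, _, _, hL⟩ := exists_extension_finrank_eq F hd
  have h := card_filter_minpoly F L fun _ => True
  simpa only [Finset.filter_true, Finset.card_univ, hL, Module.card_eq_pow_finrank (K := F)
    (V := L)] using h

theorem mul_card_primesEq_eq_sum_moebius {d : ℕ} (hd : 0 < d) :
    (d : ℤ) * (primesEq F d).card = ∑ x ∈ d.divisorsAntidiagonal,
      ArithmeticFunction.moebius x.1 * (Fintype.card F : ℤ) ^ x.2 := by
  have h := (ArithmeticFunction.sum_eq_iff_sum_mul_moebius_eq (R := ℤ)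
    (f := fun e => (e : ℤ) * (primesEq F e).card) (g := fun e => (Fintype.card F : ℤ) ^ e)).1
    (fun n hn => by exact_mod_cast (card_pow_eq_sum_mul_card_primesEq F hn).symm) d hd
  simpa using h.symm

theorem not_dvd_card_primesEq_iff (p : ℕ) [hp : Fact p.Prime] [CharP F p] {d : ℕ} (hd : 0 < d) :
    ¬ p ∣ (primesEq F d).card ↔
      ((Fintype.card F).Prime ∧ Squarefree d ∧ Fintype.card F ∣ d) ∨
        (Fintype.card F = 2 ∧ ∃ m : ℕ, Odd m ∧ Squarefree m ∧ d = 4 * m) := by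
  obtain ⟨e, -, he⟩ := FiniteField.card F p
  have h := mul_card_primesEq_eq_sum_moebius F hd
  rw [he] at h ⊢
  push_cast at h
  simp_rw [← pow_mul] at h
  rw [← padicValNat_eq_mul_div_radical_iff hp.out e.pos hd.ne']
  exact not_dvd_iff_of_mul_eq_sum_moebius hp.out (fun l => e * l) hd.ne'
    (fun l hl => Nat.mul_lt_mul_of_pos_left hl e.pos) hd.ne' h

open Classical in
-- Translation by an element of trace `1` exchanges trace `0` and trace `1`, the only two values.
theorem card_filter_trace_ne_zero (h2 : Fintype.card F = 2) :
    2 * (Finset.univ.filter fun x : L => Algebra.trace F L x ≠ 0).card =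
      2 ^ Module.finrank F L := by
  have hF : ∀ a : F, a ≠ 0 → a = 1 := by
    intro a ha
    have := FiniteField.pow_card_sub_one_eq_one a ha
    simpa [h2] using this
  obtain ⟨y, hy⟩ := Algebra.trace_surjective F L 1
  have h11 : (1 : F) + 1 = 0 := by
    by_contra hc
    have := hF _ hc
    simp at this
  have hb : (Finset.univ.filter fun x : L => Algebra.trace F L x ≠ 0).card =
      (Finset.univ.filter fun x : L => ¬ Algebra.trace F L x ≠ 0).card := by
    refine Finset.card_bij' (fun x _ => x + y) (fun x _ => x - y) ?_ ?_ ?_ ?_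
    · intro x hx
      simp only [Finset.mem_filter, Finset.mem_univ, true_and, not_not] at hx ⊢
      rw [map_add, hy, hF _ hx, h11]
    · intro x hx
      simp only [Finset.mem_filter, Finset.mem_univ, true_and, not_not] at hx ⊢
      rw [map_sub, hy, hx]
      simp
    · intros; simp
    · intros; simp
  have hs := Finset.card_filter_add_card_filter_not (s := (Finset.univ : Finset L))
    (fun x : L => Algebra.trace F L x ≠ 0)
  rw [← hb, Finset.card_univ, Module.card_eq_pow_finrank (K := F) (V := L), h2] at hs
  omega

open Classical in
/-- The number of monic irreducible polynomials of degree `d` with nonzero subleading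
coefficient. -/
def cardTraceNeZero (d : ℕ) : ℕ := ((primesEq F d).filter fun w => w.nextCoeff ≠ 0).card

open Classical in
theorem two_pow_pred_eq_sum_divisors (h2 : Fintype.card F = 2) {d : ℕ} (hd : 0 < d) :
    2 ^ (d - 1) = ∑ e ∈ d.divisors, if Odd (d / e) then e * cardTraceNeZero F e else 0 := by
  obtain ⟨L, _, _, _, hL⟩ := exists_extension_finrank_eq F hd
  have : CharP F 2 := charP_of_card_eq_prime h2
  have h := card_filter_minpoly F L fun w => ((d / w.natDegree : ℕ) : F) * -w.nextCoeff ≠ 0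
  -- The trace from `F⟮x⟯` is minus the subleading coefficient; the rest of the tower multiplies it
  -- by its degree, so in characteristic 2 only odd cofactors `d / e` survive.
  have htr : ∀ x : L, Algebra.trace F L x =
      ((d / (minpoly F x).natDegree : ℕ) : F) * -(minpoly F x).nextCoeff := by
    intro x
    have hx : IsIntegral F x := Algebra.IsIntegral.isIntegral x
    rw [trace_eq_finrank_mul_minpoly_nextCoeff, ← hL,
      ← Module.finrank_mul_finrank F F⟮x⟯ L, IntermediateField.adjoin.finrank hx,
      Nat.mul_div_cancel_left _ (minpoly.natDegree_pos hx)]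
  have h' : 2 * (∑ e ∈ (Module.finrank F L).divisors, e * ((primesEq F e).filter
      fun w => ((d / w.natDegree : ℕ) : F) * -w.nextCoeff ≠ 0).card) =
        2 ^ Module.finrank F L := by
    rw [← h, ← card_filter_trace_ne_zero F L h2]
    refine congrArg (2 * Finset.card ·) (Finset.filter_congr fun x _ => ?_)
    rw [htr]
  rw [hL] at h'
  have hpow : 2 ^ d = 2 * 2 ^ (d - 1) := by rw [← pow_succ', Nat.sub_add_cancel hd]
  rw [hpow] at h'
  rw [← Nat.eq_of_mul_eq_mul_left two_pos h']
  refine Finset.sum_congr rfl fun e _ => ?_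
  have hcast : ((d / e : ℕ) : F) ≠ 0 ↔ Odd (d / e) := by
    rw [Ne, CharP.cast_eq_zero_iff F 2, ← Nat.not_even_iff_odd, even_iff_two_dvd]
  have hfil : (primesEq F e).filter (fun w => ((d / w.natDegree : ℕ) : F) * -w.nextCoeff ≠ 0) =
      (primesEq F e).filter (fun w => ((d / e : ℕ) : F) * -w.nextCoeff ≠ 0) := by
    refine Finset.filter_congr fun w hw => ?_
    rw [((mem_primesEq F).1 hw).2.2]
  rw [hfil]
  split_ifs with ho
  · simp [cardTraceNeZero, hcast.2 ho]
  · simp [not_not.1 (mt hcast.1 ho)]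

/-- A divisor of `2 ^ a * n` with odd cofactor is `2 ^ a` times a divisor of `n`. The restricted sum
thus becomes a full divisor sum, ready for Möbius inversion over odd numbers. -/
theorem two_pow_mul_pred_eq_sum_divisors (h2 : Fintype.card F = 2) (a : ℕ) {n : ℕ} (hn : Odd n) :
    2 ^ (2 ^ a * n - 1) = ∑ e ∈ n.divisors, 2 ^ a * e * cardTraceNeZero F (2 ^ a * e) := by
  have h2a : 0 < 2 ^ a := Nat.two_pow_pos a
  rw [two_pow_pred_eq_sum_divisors F h2 (Nat.mul_pos h2a hn.pos), ← Finset.sum_filter]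
  symm
  refine Finset.sum_bij (fun e _ => 2 ^ a * e) ?_ ?_ ?_ ?_
  · intro e he
    rw [Nat.mem_divisors] at he
    rw [Finset.mem_filter, Nat.mem_divisors, Nat.mul_div_mul_left _ _ h2a]
    exact ⟨⟨Nat.mul_dvd_mul_left _ he.1, (Nat.mul_pos h2a hn.pos).ne'⟩,
      hn.of_dvd_nat (Nat.div_dvd_of_dvd he.1)⟩
  · intro e _ e' _ h
    exact Nat.eq_of_mul_eq_mul_left h2a h
  · intro e he
    rw [Finset.mem_filter, Nat.mem_divisors] at he
    obtain ⟨⟨hdvd, -⟩, hodd⟩ := he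
    obtain ⟨c, hc⟩ := hdvd
    have he0 : 0 < e := Nat.pos_of_ne_zero (by
      rintro rfl
      rw [zero_mul] at hc
      exact (Nat.mul_pos h2a hn.pos).ne' hc)
    rw [hc, Nat.mul_div_cancel_left _ he0] at hodd
    have h2e : 2 ^ a ∣ e :=
      (Nat.Coprime.pow_left a (Nat.coprime_two_left.2 hodd)).dvd_of_dvd_mul_right
        (hc ▸ dvd_mul_right _ _)
    obtain ⟨m, rfl⟩ := h2e
    refine ⟨m, ?_, rfl⟩
    rw [Nat.mem_divisors]
    refine ⟨⟨c, ?_⟩, hn.pos.ne'⟩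
    rw [mul_assoc] at hc
    exact Nat.eq_of_mul_eq_mul_left h2a hc
  · intros; rfl

theorem odd_cardTraceNeZero_iff (h2 : Fintype.card F = 2) {d : ℕ} (hd : 0 < d) :
    Odd (cardTraceNeZero F d) ↔ Squarefree d := by
  obtain ⟨a, n, hn2, rfl⟩ := Nat.exists_eq_pow_mul_and_not_dvd hd.ne' 2 (by norm_num)
  have hn : Odd n := Nat.not_even_iff_odd.1 (mt Even.two_dvd hn2)
  have h := (ArithmeticFunction.sum_eq_iff_sum_mul_moebius_eq_on (R := ℤ)
    (f := fun e => ((2 ^ a * e : ℕ) : ℤ) * cardTraceNeZero F (2 ^ a * e))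
    (g := fun e => (2 : ℤ) ^ (2 ^ a * e - 1)) {m | Odd m}
    (fun m m' hm hm' => Odd.of_dvd_nat hm' hm)).1
    (fun m _ hm => by exact_mod_cast (two_pow_mul_pred_eq_sum_divisors F h2 a hm).symm)
    n hn.pos hn
  have hdiv : 0 < n / radical n :=
    Nat.div_pos (Nat.radical_le_self_iff.2 hn.pos.ne') (Nat.radical_pos n)
  have h' := not_dvd_iff_of_mul_eq_sum_moebius Nat.prime_two (fun l => 2 ^ a * l - 1) hn.pos.ne'
    (fun l hl => by
      have h1 := Nat.mul_lt_mul_of_pos_left hl (Nat.two_pow_pos a)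
      have h0 := Nat.mul_pos (Nat.two_pow_pos a) hdiv
      show 2 ^ a * _ - 1 < 2 ^ a * l - 1
      omega)
    hd.ne' (by simpa using h.symm)
  rw [← Nat.not_even_iff_odd, even_iff_two_dvd, h', ← squarefree_two_pow_mul_iff hn,
    padicValNat.mul (Nat.two_pow_pos a).ne' hn.pos.ne', padicValNat.prime_pow,
    padicValNat.eq_zero_of_not_dvd hn2, add_zero]

end Counting

/-! ### Laurent expansions at infinity and their first two coefficients. -/

section Expansion

variable {F : Type*} [Field F]

theorem orderTop_polyAtInfty {f : F[X]} (hf : f ≠ 0) :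
    (polyAtInfty F f).orderTop = ((-(f.natDegree : ℤ) : ℤ) : WithTop ℤ) := by
  refine HahnSeries.orderTop_eq_of_le ?_ fun j hj => ?_
  · rw [HahnSeries.mem_support, coeff_polyAtInfty]
    exact leadingCoeff_ne_zero.2 hf
  · by_contra! hlt
    obtain ⟨n, rfl⟩ : ∃ n : ℕ, j = -(n : ℤ) := ⟨j.natAbs, by omega⟩
    rw [HahnSeries.mem_support, coeff_polyAtInfty] at hj
    exact hj (coeff_eq_zero_of_natDegree_lt (by omega))

theorem expandInfty_algebraMap (f : F[X]) :
    expandInfty F (algebraMap F[X] (RatFunc F) f) = polyAtInfty F f := by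
  rw [expandInfty, IsFractionRing.lift_algebraMap]

theorem vInfty_algebraMap_div {f g : F[X]} (hf : f ≠ 0) (hg : g ≠ 0) :
    vInfty (algebraMap F[X] (RatFunc F) f / algebraMap F[X] (RatFunc F) g) =
      (((g.natDegree : ℤ) - f.natDegree : ℤ) : WithTop ℤ) := by
  have hf' := (map_ne_zero_iff _ (RatFunc.algebraMap_injective F)).2 hf
  have hg' := (map_ne_zero_iff _ (RatFunc.algebraMap_injective F)).2 hg
  rw [vInfty, if_neg (div_ne_zero hf' hg'), RatFunc.intDegree_div hf' hg',
    RatFunc.intDegree_polynomial, RatFunc.intDegree_polynomial, neg_sub]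

theorem vInfty_eq_orderTop (f : RatFunc F) : vInfty f = (expandInfty F f).orderTop := by
  by_cases h0 : f = 0
  · simp [h0, vInfty]
  induction f using RatFunc.induction_on with
  | f a b hb =>
    have ha : a ≠ 0 := by rintro rfl; simp at h0
    have hb' := (map_ne_zero_iff _ (RatFunc.algebraMap_injective F)).2 hb
    rw [vInfty_algebraMap_div ha hb]
    have h : expandInfty F (algebraMap F[X] (RatFunc F) a / algebraMap F[X] (RatFunc F) b) *
        polyAtInfty F b = polyAtInfty F a := by
      rw [← expandInfty_algebraMap, ← map_mul, div_mul_cancel₀ _ hb', expandInfty_algebraMap]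
    have h' := congrArg HahnSeries.orderTop h
    rw [HahnSeries.orderTop_mul, orderTop_polyAtInfty ha, orderTop_polyAtInfty hb] at h'
    generalize (expandInfty F (algebraMap F[X] (RatFunc F) a /
      algebraMap F[X] (RatFunc F) b)).orderTop = z at h' ⊢
    induction z using WithTop.recTopCoe with
    | top => exact absurd h' (by rw [WithTop.top_add]; exact WithTop.top_ne_coe)
    | coe z =>
      rw [← WithTop.coe_add, WithTop.coe_inj] at h'
      rw [WithTop.coe_inj]
      omega

/-- Dividing `f` by `t ^ deg f` and writing the result in `s = 1 / t` reverses the coefficients. -/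
theorem polyAtInfty_mul_single_pow (f : F[X]) :
    polyAtInfty F f * HahnSeries.ofPowerSeries ℤ F PowerSeries.X ^ f.natDegree =
      HahnSeries.ofPowerSeries ℤ F (f.reverse : PowerSeries F) := by
  have hx : (HahnSeries.single (-1 : ℤ) (1 : F)) * HahnSeries.single (1 : ℤ) (1 : F) = 1 := by
    simp
  let : Invertible (HahnSeries.single (-1 : ℤ) (1 : F)) :=
    ⟨HahnSeries.single (1 : ℤ) (1 : F), by rw [mul_comm]; exact hx, hx⟩
  have h := eval₂_reverse_mul_pow (HahnSeries.C : F →+* F⸨X⸩)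
    (HahnSeries.single (-1 : ℤ) (1 : F)) f
  have h2 : eval₂ (HahnSeries.C : F →+* F⸨X⸩) (HahnSeries.single (1 : ℤ) (1 : F)) f.reverse =
      HahnSeries.ofPowerSeries ℤ F (f.reverse : PowerSeries F) := by
    have h3 : (eval₂RingHom (HahnSeries.C : F →+* F⸨X⸩) (HahnSeries.single (1 : ℤ) (1 : F))) =
        (HahnSeries.ofPowerSeries ℤ F).comp coeToPowerSeries.ringHom := by
      apply Polynomial.ringHom_ext
      · intro a; simp
      · simp
    exact RingHom.congr_fun h3 f.reverse
  have h4 : polyAtInfty F f = eval₂ (HahnSeries.C : F →+* F⸨X⸩)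
    (HahnSeries.single (-1 : ℤ) (1 : F)) f := rfl
  rw [h4, ← h, ← h2, HahnSeries.ofPowerSeries_X, mul_assoc, ← mul_pow, hx, one_pow, mul_one]
  rfl

/-- The power series `1 / (U ^ k - s ^ (d * k))`, where `U` is the expansion of `w / t ^ d` in
`s = 1 / t` and `d` is the degree of `w`. -/
def unitPart (w : F[X]) (k : ℕ) : PowerSeries F :=
  ((w.reverse : PowerSeries F) ^ k - PowerSeries.X ^ (w.natDegree * k))⁻¹

theorem constantCoeff_inv_unitPart {w : F[X]} (hm : w.Monic) (hd : 0 < w.natDegree) {k : ℕ}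
    (hk : 0 < k) : PowerSeries.constantCoeff
      ((w.reverse : PowerSeries F) ^ k - PowerSeries.X ^ (w.natDegree * k)) = 1 := by
  have : w.natDegree * k ≠ 0 := (Nat.mul_pos hd hk).ne'
  rw [map_sub, map_pow, map_pow, PowerSeries.constantCoeff_X, zero_pow this, sub_zero,
    ← PowerSeries.coeff_zero_eq_constantCoeff_apply, Polynomial.coeff_coe, coeff_zero_reverse,
    hm.leadingCoeff, one_pow]

theorem constantCoeff_unitPart {w : F[X]} (hm : w.Monic) (hd : 0 < w.natDegree) {k : ℕ}
    (hk : 0 < k) : PowerSeries.coeff 0 (unitPart w k) = 1 := by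
  rw [unitPart, PowerSeries.coeff_inv, if_pos rfl, constantCoeff_inv_unitPart hm hd hk, inv_one]

theorem coeff_one_unitPart {w : F[X]} (hm : w.Monic) (hd : 0 < w.natDegree) {k : ℕ}
    (hk : 0 < k) : PowerSeries.coeff 1 (unitPart w k) =
      (if w.natDegree * k = 1 then 1 else 0) - k * w.nextCoeff := by
  have h1 := constantCoeff_inv_unitPart hm hd hk
  have h0 := constantCoeff_unitPart hm hd hk
  have hmul := PowerSeries.mul_inv_cancel _ (h1.symm ▸ one_ne_zero)
  have := congrArg (PowerSeries.coeff 1) hmul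
  rw [← unitPart, PowerSeries.coeff_one_mul, h1, ← PowerSeries.coeff_zero_eq_constantCoeff_apply,
    h0, map_sub, PowerSeries.coeff_one_pow, PowerSeries.coeff_X_pow, Polynomial.coeff_coe,
    coeff_one_reverse, ← PowerSeries.coeff_zero_eq_constantCoeff_apply, Polynomial.coeff_coe,
    coeff_zero_reverse, hm.leadingCoeff, PowerSeries.coeff_one, if_neg one_ne_zero] at this
  simp only [one_pow, mul_one, eq_comm (a := 1)] at this
  linear_combination this

/-- With `w = s ^ (-d) * U`, one has `1 - w ^ k = -s ^ (-d k) * (U ^ k - s ^ (d k))`. -/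
theorem expandInfty_one_div_one_sub_pow {w : F[X]} (hm : w.Monic) (hd : 0 < w.natDegree) {k : ℕ}
    (hk : 0 < k) :
    expandInfty F (1 / (1 - algebraMap F[X] (RatFunc F) w ^ k)) =
      HahnSeries.ofPowerSeries ℤ F (PowerSeries.X ^ (w.natDegree * k) * -unitPart w k) := by
  rw [map_div₀, map_one, map_sub, map_one, map_pow, expandInfty_algebraMap]
  refine (eq_one_div_of_mul_eq_one_right ?_).symm
  have hmul := PowerSeries.mul_inv_cancel _
    ((constantCoeff_inv_unitPart hm hd hk).symm ▸ one_ne_zero)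
  have h := congrArg (HahnSeries.ofPowerSeries ℤ F) hmul
  rw [← unitPart, map_mul, map_sub, map_pow, map_pow, ← polyAtInfty_mul_single_pow, map_one] at h
  rw [map_mul, map_neg, map_pow]
  linear_combination h

theorem coeff_ofPowerSeries_X_pow_mul_add (D i : ℕ) (R : PowerSeries F) :
    (HahnSeries.ofPowerSeries ℤ F (PowerSeries.X ^ D * R)).coeff ((D : ℤ) + i) =
      PowerSeries.coeff i R := by
  rw [← Nat.cast_add, LaurentSeries.coeff_coe_powerSeries, add_comm, PowerSeries.coeff_X_pow_mul]

theorem coeff_ofPowerSeries_X_pow_mul_of_lt (D : ℕ) (R : PowerSeries F) {j : ℤ} (hj : j < D) :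
    (HahnSeries.ofPowerSeries ℤ F (PowerSeries.X ^ D * R)).coeff j = 0 := by
  rw [PowerSeries.coeff_coe]
  split_ifs with h
  · rfl
  · rw [PowerSeries.coeff_X_pow_mul', if_neg (by omega)]

theorem le_orderTop_ofPowerSeries (D : ℕ) (R : PowerSeries F) :
    ((D : ℤ) : WithTop ℤ) ≤ (HahnSeries.ofPowerSeries ℤ F (PowerSeries.X ^ D * R)).orderTop :=
  HahnSeries.le_orderTop_iff_forall.2 fun _ hj =>
    coeff_ofPowerSeries_X_pow_mul_of_lt D R (WithTop.coe_lt_coe.1 hj)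

theorem orderTop_ofPowerSeries_eq_iff (D : ℕ) (R : PowerSeries F) :
    (HahnSeries.ofPowerSeries ℤ F (PowerSeries.X ^ D * R)).orderTop = ((D : ℤ) : WithTop ℤ) ↔
      PowerSeries.coeff 0 R ≠ 0 := by
  rw [← coeff_ofPowerSeries_X_pow_mul_add D 0 R, Nat.cast_zero, add_zero]
  constructor
  · exact HahnSeries.coeff_orderTop_ne
  · exact fun h => le_antisymm (HahnSeries.orderTop_le_of_coeff_ne_zero h)
      (le_orderTop_ofPowerSeries D R)

theorem exists_X_pow_succ_mul_eq {D : ℕ} {R : PowerSeries F} (h0 : PowerSeries.coeff 0 R = 0) :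
    ∃ R', PowerSeries.X ^ D * R = PowerSeries.X ^ (D + 1) * R' ∧
      PowerSeries.coeff 0 R' = PowerSeries.coeff 1 R := by
  obtain ⟨R', rfl⟩ := PowerSeries.X_dvd_iff.2
    ((PowerSeries.coeff_zero_eq_constantCoeff_apply R).symm.trans h0)
  refine ⟨R', by ring, ?_⟩
  exact (PowerSeries.coeff_succ_X_mul 0 R').symm

theorem orderTop_ofPowerSeries_eq_add_one_iff {D : ℕ} {R : PowerSeries F}
    (h0 : PowerSeries.coeff 0 R = 0) :
    (HahnSeries.ofPowerSeries ℤ F (PowerSeries.X ^ D * R)).orderTop =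
      ((D + 1 : ℤ) : WithTop ℤ) ↔ PowerSeries.coeff 1 R ≠ 0 := by
  obtain ⟨R', hR, h1⟩ := exists_X_pow_succ_mul_eq (D := D) h0
  rw [hR, ← h1]
  exact_mod_cast orderTop_ofPowerSeries_eq_iff (D + 1) R'

theorem add_one_le_orderTop_ofPowerSeries {D : ℕ} {R : PowerSeries F}
    (h0 : PowerSeries.coeff 0 R = 0) :
    ((D + 1 : ℤ) : WithTop ℤ) ≤
      (HahnSeries.ofPowerSeries ℤ F (PowerSeries.X ^ D * R)).orderTop := by
  obtain ⟨R', hR, -⟩ := exists_X_pow_succ_mul_eq (D := D) h0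
  rw [hR]
  exact_mod_cast le_orderTop_ofPowerSeries (D + 1) R'

variable (F) [Fintype F]

theorem expandInfty_PEq {d k : ℕ} (hd : 0 < d) (hk : 0 < k) :
    expandInfty F (PEq F d k) = HahnSeries.ofPowerSeries ℤ F
      (PowerSeries.X ^ (d * k) * ∑ w ∈ primesEq F d, -unitPart w k) := by
  rw [PEq, map_sum, Finset.mul_sum, map_sum]
  refine Finset.sum_congr rfl fun w hw => ?_
  obtain ⟨hm, -, rfl⟩ := (mem_primesEq F).1 hw
  exact expandInfty_one_div_one_sub_pow hm hd hk

theorem coeff_zero_sum_unitPart {d k : ℕ} (hd : 0 < d) (hk : 0 < k) :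
    PowerSeries.coeff 0 (∑ w ∈ primesEq F d, -unitPart w k) = -((primesEq F d).card : F) := by
  rw [map_sum, Finset.sum_congr rfl (g := fun _ => (-1 : F))]
  · simp
  · intro w hw
    obtain ⟨hm, -, rfl⟩ := (mem_primesEq F).1 hw
    rw [map_neg, constantCoeff_unitPart hm hd hk]

theorem coeff_one_sum_unitPart {d k : ℕ} (hd : 0 < d) (hk : 0 < k) :
    PowerSeries.coeff 1 (∑ w ∈ primesEq F d, -unitPart w k) =
      k * ∑ w ∈ primesEq F d, w.nextCoeff - if d * k = 1 then ((primesEq F d).card : F) else 0 := by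
  rw [map_sum, Finset.sum_congr rfl
    (g := fun w : F[X] => (k : F) * w.nextCoeff - if d * k = 1 then 1 else 0)]
  · rw [Finset.sum_sub_distrib, Finset.mul_sum]
    congr 1
    split_ifs <;> simp
  · intro w hw
    obtain ⟨hm, -, rfl⟩ := (mem_primesEq F).1 hw
    rw [map_neg, coeff_one_unitPart hm hd hk]
    ring

theorem sum_nextCoeff_eq_cardTraceNeZero (h2 : Fintype.card F = 2) (d : ℕ) :
    ∑ w ∈ primesEq F d, w.nextCoeff = (cardTraceNeZero F d : F) := by
  classical
  have hF : ∀ a : F, a ≠ 0 → a = 1 := fun a ha => by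
    simpa [h2] using FiniteField.pow_card_sub_one_eq_one a ha
  rw [cardTraceNeZero, Finset.card_filter, Nat.cast_sum]
  refine Finset.sum_congr rfl fun w _ => ?_
  by_cases h : w.nextCoeff = 0
  · simp [h]
  · simp [hF _ h]

theorem coeff_one_sum_unitPart_ne_zero_iff (h2 : Fintype.card F = 2) {d k : ℕ} (hd : 0 < d)
    (hk : Odd k) :
    PowerSeries.coeff 1 (∑ w ∈ primesEq F d, -unitPart w k) ≠ 0 ↔ Squarefree d := by
  have : CharP F 2 := charP_of_card_eq_prime h2
  have hk1 : (k : F) = 1 := by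
    obtain ⟨c, rfl⟩ := hk
    simp [CharTwo.two_eq_zero]
  -- The extra term occurs only for `d = k = 1`; it is then the number of linear primes, which is
  -- even because `d = 1` meets neither case of the criterion.
  have hN : (if d * k = 1 then ((primesEq F d).card : F) else 0) = 0 := by
    split_ifs with h
    · rw [CharP.cast_eq_zero_iff F 2]
      by_contra hc
      rw [not_dvd_card_primesEq_iff F 2 hd, (mul_eq_one.1 h).1, h2] at hc
      rcases hc with ⟨-, -, h⟩ | ⟨-, m, -, -, h⟩ <;> omega
    · rfl
  rw [coeff_one_sum_unitPart F hd hk.pos, hN, sub_zero, hk1, one_mul,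
    sum_nextCoeff_eq_cardTraceNeZero F h2, ← odd_cardTraceNeZero_iff F h2 hd, Ne,
    CharP.cast_eq_zero_iff F 2, ← Nat.not_even_iff_odd, even_iff_two_dvd]

end Expansion

/-! ### Polynomials invariant under affine substitutions and Frobenius. -/

section Invariants

theorem exists_algebraMap_zmod_eq (p : ℕ) [hp : Fact p.Prime] {F : Type*} [Field F]
    [Algebra (ZMod p) F] {x : F} (hx : x ^ p = x) : ∃ z, algebraMap (ZMod p) F z = x := by
  classical
  have hne := FiniteField.X_pow_card_sub_X_ne_zero F hp.out.one_lt
  have hsub : Finset.univ.image (algebraMap (ZMod p) F) ⊆ (X ^ p - X : F[X]).roots.toFinset := by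
    intro y hy
    obtain ⟨z, -, rfl⟩ := Finset.mem_image.1 hy
    rw [Multiset.mem_toFinset, mem_roots hne, IsRoot.def]
    simp [← map_pow]
  have hcard : (X ^ p - X : F[X]).roots.toFinset.card ≤
      (Finset.univ.image (algebraMap (ZMod p) F)).card := by
    rw [Finset.card_image_of_injective _ (algebraMap (ZMod p) F).injective, Finset.card_univ,
      ZMod.card]
    exact (Multiset.toFinset_card_le _).trans ((card_roots' _).trans
      (FiniteField.X_pow_card_sub_X_natDegree_eq F hp.out.one_lt).le)
  have hmem : x ∈ (X ^ p - X : F[X]).roots.toFinset := by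
    rw [Multiset.mem_toFinset, mem_roots hne, IsRoot.def]
    simp [hx]
  rw [← Finset.eq_of_subset_of_card_le hsub hcard] at hmem
  obtain ⟨z, -, hz⟩ := Finset.mem_image.1 hmem
  exact ⟨z, hz⟩

theorem aeval_eq_map_comp {K A : Type*} [CommRing K] [CommRing A] [Algebra K A] (f : K[X]) (g : A[X]) :
    aeval g f = (f.map (algebraMap K A)).comp g := by
  rw [comp, eval₂_map, aeval_def]
  rfl

variable (F : Type*) [Field F] [Fintype F]

/-- `[1] = t ^ q - t` as a polynomial. -/
def polyBracket : F[X] := X ^ Fintype.card F - X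

theorem polyBracket_eq_prod :
    polyBracket F = ((Finset.univ : Finset F).val.map fun a => X - C a).prod := by
  have hroots := FiniteField.roots_X_pow_card_sub_X F
  have hm : (polyBracket F).Monic :=
    monic_X_pow_sub (by rw [degree_X]; exact_mod_cast Fintype.one_lt_card)
  rw [polyBracket] at hm ⊢
  have := prod_multiset_X_sub_C_of_monic_of_roots_card_eq hm (by
    rw [hroots, FiniteField.X_pow_card_sub_X_natDegree_eq F Fintype.one_lt_card]
    rfl)
  rw [← this, hroots]

theorem natDegree_polyBracket : (polyBracket F).natDegree = Fintype.card F :=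
  FiniteField.X_pow_card_sub_X_natDegree_eq F Fintype.one_lt_card

theorem polyBracket_ne_zero : polyBracket F ≠ 0 :=
  FiniteField.X_pow_card_sub_X_ne_zero F Fintype.one_lt_card

theorem polyBracket_dvd {f : F[X]} (h : ∀ a, f.eval a = 0) : polyBracket F ∣ f := by
  by_cases hf : f = 0
  · simp [hf]
  rw [polyBracket_eq_prod, Multiset.prod_X_sub_C_dvd_iff_le_roots hf,
    Multiset.le_iff_subset Finset.univ.nodup]
  intro a _
  exact (mem_roots hf).2 (h a)

theorem polyBracket_comp_X_add_C (a : F) :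
    (polyBracket F).comp (X + C a) = polyBracket F := by
  obtain ⟨p, hp⟩ := CharP.exists F
  have : Fact p.Prime := ⟨CharP.char_is_prime F p⟩
  obtain ⟨n, -, hn⟩ := FiniteField.card F p
  have h : (X + C a : F[X]) ^ Fintype.card F = X ^ Fintype.card F + C a := by
    have ha : C a ^ Fintype.card F = C a := by rw [← C_pow, FiniteField.pow_card]
    conv_rhs => rw [← ha]
    rw [hn, add_pow_char_pow]
  rw [polyBracket, sub_comp, pow_comp, X_comp, h]
  ring

theorem polyBracket_comp_C_mul_X (c : F) :
    (polyBracket F).comp (C c * X) = C c * polyBracket F := by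
  rw [polyBracket, sub_comp, pow_comp, X_comp, mul_pow, ← C_pow, FiniteField.pow_card]
  ring

variable {F}

theorem comp_polyBracket_injective : Function.Injective fun f : F[X] => f.comp (polyBracket F) := by
  intro f g h
  rw [← sub_eq_zero] at h ⊢
  simp only [← sub_comp] at h
  rcases comp_eq_zero_iff.1 h with h | ⟨-, h⟩
  · exact h
  · have h1 := natDegree_polyBracket F
    rw [h, natDegree_C] at h1
    exact absurd h1.symm Fintype.card_ne_zero

variable (p : ℕ) [hp : Fact p.Prime] [Algebra (ZMod p) F]

/-- Translation invariance gives `f(a) = f(0)` for all `a` in `F`, so `[1]` divides `f - f(0)`. The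
quotient has the same invariances and smaller degree, and Frobenius puts `f(0)` in the prime field.
-/
theorem exists_aeval_polyBracket_eq [CharP F p] (f : F[X]) (hadd : ∀ a, f.comp (X + C a) = f)
    (hfrob : f.map (frobenius F p) = f) : ∃ g : (ZMod p)[X], aeval (polyBracket F) g = f := by
  induction hn : f.natDegree using Nat.strong_induction_on generalizing f with
  | _ n ih =>
    have hc : (f.coeff 0) ^ p = f.coeff 0 := by
      conv_rhs => rw [← hfrob, coeff_map, frobenius_def]
    obtain ⟨z, hz⟩ := exists_algebraMap_zmod_eq p hc
    by_cases h0 : f.natDegree = 0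
    · refine ⟨C z, ?_⟩
      rw [eq_C_of_natDegree_eq_zero h0, aeval_C, ← hz]
      rfl
    obtain ⟨h, hh⟩ : polyBracket F ∣ f - C (f.coeff 0) := by
      refine polyBracket_dvd F fun a => ?_
      have := congrArg (eval 0) (hadd a)
      rw [eval_comp] at this
      rw [eval_sub, eval_C, coeff_zero_eq_eval_zero, ← this]
      simp
    have hB := polyBracket_ne_zero F
    have hdeg : h.natDegree < n := by
      have h1 : (f - C (f.coeff 0)).natDegree = n := by rw [natDegree_sub_C, hn]
      have hh0 : h ≠ 0 := by
        rintro rfl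
        rw [mul_zero] at hh
        rw [hh, natDegree_zero] at h1
        omega
      rw [hh, natDegree_mul hB hh0, natDegree_polyBracket] at h1
      have := Fintype.card_pos (α := F)
      omega
    obtain ⟨g, hg⟩ := ih _ hdeg h (fun a => by
      have := congrArg (fun u => u.comp (X + C a)) hh
      simp only [sub_comp, mul_comp, hadd, C_comp, polyBracket_comp_X_add_C] at this
      rw [hh] at this
      exact (mul_left_cancel₀ hB this).symm) (by
      have := congrArg (map (frobenius F p)) hh
      rw [Polynomial.map_sub, Polynomial.map_mul, hfrob, map_C, frobenius_def, hc, hh,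
        show (polyBracket F).map (frobenius F p) = polyBracket F by simp [polyBracket]] at this
      exact (mul_left_cancel₀ hB this).symm) rfl
    refine ⟨X * g + C z, ?_⟩
    rw [map_add, map_mul, aeval_X, hg, ← hh, aeval_C]
    change f - C (f.coeff 0) + C _ = f
    rw [hz]
    ring

/-- The dilation by a generator `u` of the unit group multiplies `[1]` by `u`. A term `[1] ^ i` can
then occur only if `u ^ i = 1`, that is, if `q - 1 ∣ i`. -/
theorem exists_aeval_polyBracket_pow_eq [CharP F p] (f : F[X])
    (hadd : ∀ a, f.comp (X + C a) = f) (hmul : ∀ c, c ≠ 0 → f.comp (C c * X) = f)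
    (hfrob : f.map (frobenius F p) = f) :
    ∃ g : (ZMod p)[X], aeval (polyBracket F ^ (Fintype.card F - 1)) g = f := by
  obtain ⟨g, hg⟩ := exists_aeval_polyBracket_eq p f hadd hfrob
  have hq : 0 < Fintype.card F - 1 := Nat.sub_pos_of_lt Fintype.one_lt_card
  obtain ⟨u, hu⟩ := IsCyclic.exists_ofOrder_eq_natCard (α := Fˣ)
  rw [Nat.card_units, Nat.card_eq_fintype_card] at hu
  have hcomp : (g.map (algebraMap (ZMod p) F)).comp (C (u : F) * X) =
      g.map (algebraMap (ZMod p) F) := by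
    apply comp_polyBracket_injective
    have h := hmul u u.ne_zero
    rw [← hg, aeval_eq_map_comp, comp_assoc, polyBracket_comp_C_mul_X] at h
    simp only [comp_assoc, mul_comp, C_comp, X_comp]
    exact h
  have hsupp : ∀ i, g.coeff i ≠ 0 → Fintype.card F - 1 ∣ i := by
    intro i hi
    have h := congrArg (coeff · i) hcomp
    simp only [comp_C_mul_X_coeff, coeff_map] at h
    have hi' : algebraMap (ZMod p) F (g.coeff i) ≠ 0 :=
      (map_ne_zero_iff _ (algebraMap (ZMod p) F).injective).2 hi
    have h1 : (u : F) ^ i = 1 := by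
      refine mul_left_cancel₀ hi' ?_
      rw [h, mul_one]
    rw [← hu]
    exact orderOf_dvd_of_pow_eq_one (Units.ext (by simpa using h1))
  refine ⟨contract (Fintype.card F - 1) g, ?_⟩
  rw [← expand_aeval, ← hg]
  congr 1
  ext i
  rw [coeff_expand hq]
  split_ifs with hi
  · rw [coeff_contract hq.ne', Nat.div_mul_cancel hi]
  · by_contra hne
    exact hi (hsupp i (Ne.symm hne))

end Invariants

/-! ### Prime sums as quotients of invariant polynomials. -/

section Symmetry

variable {F : Type*} [Field F]

/-- The polynomial `∏ (Y - w ^ k)` over `w ∈ S`. -/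
def powPoly (S : Finset F[X]) (k : ℕ) : F[X][X] := ∏ w ∈ S, (X - C (w ^ k))

theorem map_powPoly [Fintype F] {S : Finset F[X]} (hirr : ∀ w ∈ S, w.Monic ∧ Irreducible w)
    (hclosed : ∀ w ∈ S, ∀ w' : F[X], w'.Monic → Irreducible w' → w'.natDegree = w.natDegree →
      w' ∈ S) {k : ℕ} (hk : (Fintype.card F - 1) ∣ k) (σ : F[X] ≃+* F[X])
    (hσ : ∀ f, (σ f).natDegree = f.natDegree) :
    (powPoly S k).map (σ : F[X] →+* F[X]) = powPoly S k := by
  classical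
  -- The image of a prime under `σ` need not be monic; normalising it gives a permutation of `S`,
  -- and the scalar disappears in the `k`-th power.
  let τ : F[X] → F[X] := fun w => C (σ w).leadingCoeff⁻¹ * σ w
  have hlc : ∀ w ∈ S, (σ w).leadingCoeff ≠ 0 := fun w hw =>
    leadingCoeff_ne_zero.2 ((map_ne_zero_iff _ σ.injective).2 (hirr w hw).2.ne_zero)
  have hunit : ∀ w ∈ S, IsUnit (C (σ w).leadingCoeff⁻¹) := fun w hw =>
    isUnit_C.2 (isUnit_iff_ne_zero.2 (inv_ne_zero (hlc w hw)))
  have hpow : ∀ w ∈ S, τ w ^ k = σ (w ^ k) := by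
    intro w hw
    obtain ⟨m, rfl⟩ := hk
    rw [mul_pow, ← C_pow, pow_mul _ _ m,
      FiniteField.pow_card_sub_one_eq_one _ (inv_ne_zero (hlc w hw)), one_pow, C_1, one_mul,
      map_pow]
  have hmaps : ∀ w ∈ S, τ w ∈ S := by
    intro w hw
    refine hclosed w hw _ ?_ ?_ ?_
    · rw [Monic, leadingCoeff_mul, leadingCoeff_C, inv_mul_cancel₀ (hlc w hw)]
    · rw [irreducible_isUnit_mul (hunit w hw), MulEquiv.irreducible_iff]
      exact (hirr w hw).2
    · rw [natDegree_C_mul (inv_ne_zero (hlc w hw)), hσ]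
  have hinj : Set.InjOn τ S := by
    intro w hw w' hw' h
    refine eq_of_monic_of_associated (hirr w hw).1 (hirr w' hw').1 ?_
    have h1 : Associated (σ w) (σ w') :=
      ((associated_unit_mul_left _ _ (hunit w hw)).symm.trans (by
        change Associated (τ w) (τ w')
        rw [h])).trans (associated_unit_mul_left _ _ (hunit w' hw'))
    simpa using h1.map (σ.symm : F[X] →* F[X])
  have himg : S.image τ = S :=
    Finset.eq_of_subset_of_card_le (Finset.image_subset_iff.2 hmaps)
      (Finset.card_image_of_injOn hinj).ge
  conv_rhs => rw [powPoly, ← himg, Finset.prod_image hinj]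
  rw [powPoly, Polynomial.map_prod]
  refine Finset.prod_congr rfl fun w hw => ?_
  rw [Polynomial.map_sub, map_X, map_C, hpow w hw]
  rfl

theorem eval_one_powPoly (S : Finset F[X]) (k : ℕ) :
    (powPoly S k).eval 1 = ∏ w ∈ S, (1 - w ^ k) := by
  simp [powPoly, eval_prod]

theorem sum_one_div_eq_div {S : Finset F[X]} {k : ℕ} (hk : 0 < k)
    (hirr : ∀ w ∈ S, Irreducible w) :
    (powPoly S k).eval 1 ≠ 0 ∧
      ∑ w ∈ S, 1 / (1 - algebraMap F[X] (RatFunc F) w ^ k) =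
        algebraMap F[X] (RatFunc F) ((derivative (powPoly S k)).eval 1) /
          algebraMap F[X] (RatFunc F) ((powPoly S k).eval 1) := by
  classical
  have hne : ∀ w ∈ S, (1 : F[X]) - w ^ k ≠ 0 := by
    intro w hw h
    exact (hirr w hw).not_isUnit (IsUnit.of_pow_eq_one (sub_eq_zero.1 h).symm hk.ne')
  have hprod : (powPoly S k).eval 1 ≠ 0 := by
    rw [eval_one_powPoly]
    exact Finset.prod_ne_zero_iff.2 hne
  refine ⟨hprod, ?_⟩
  have hinj := RatFunc.algebraMap_injective F
  rw [eq_div_iff ((map_ne_zero_iff _ hinj).2 hprod), powPoly, derivative_prod_finset,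
    Finset.sum_mul, eval_finsetSum, map_sum]
  refine Finset.sum_congr rfl fun w hw => ?_
  have hw' := (map_ne_zero_iff (algebraMap F[X] (RatFunc F)) hinj).2 (hne w hw)
  have hmap : 1 - algebraMap F[X] (RatFunc F) w ^ k = algebraMap F[X] (RatFunc F) (1 - w ^ k) := by
    rw [map_sub, map_one, map_pow]
  rw [hmap, ← Finset.mul_prod_erase S _ hw]
  simp only [eval_mul, eval_prod, eval_sub, eval_X, eval_C, derivative_sub, derivative_X,
    derivative_C, sub_zero, mul_one, map_mul]
  rw [← mul_assoc, one_div_mul_cancel hw', one_mul]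

/-- Translations, dilations and Frobenius on coefficients are all degree-preserving ring
automorphisms; the last is not `F`-linear, hence the use of ring equivalences. -/
theorem exists_aeval_eq_of_map_eq [Fintype F] (p : ℕ) [hp : Fact p.Prime] [Algebra (ZMod p) F]
    {f : F[X]} (h : ∀ σ : F[X] ≃+* F[X], (∀ f, (σ f).natDegree = f.natDegree) → σ f = f) :
    ∃ g : (ZMod p)[X], aeval (polyBracket F ^ (Fintype.card F - 1)) g = f := by
  have : CharP F p := charP_of_injective_algebraMap (algebraMap (ZMod p) F).injective p
  refine exists_aeval_polyBracket_pow_eq p f (fun a => ?_) (fun c hc => ?_) ?_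
  · refine h (algEquivAevalXAddC a : F[X] ≃ₐ[F] F[X]).toRingEquiv fun f => ?_
    change (f.comp (X + C a)).natDegree = _
    rw [natDegree_comp, natDegree_X_add_C, mul_one]
  · let : Invertible c := invertibleOfNonzero hc
    have h1 : ∀ f : F[X], (algEquivCMulXAddC c 0 : F[X] ≃ₐ[F] F[X]).toRingEquiv f =
        f.comp (C c * X) := by
      intro f
      change aeval _ f = _
      rw [C_0, add_zero]
      rfl
    rw [← h1]
    refine h _ fun f => ?_
    rw [h1, natDegree_comp, natDegree_C_mul_X c hc, mul_one]
  · refine h (mapEquiv (frobeniusEquiv F p)) fun f => ?_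
    exact natDegree_map_eq_of_injective (frobeniusEquiv F p).injective f

theorem exists_sum_eq_div_aeval [Fintype F] (p : ℕ) [hp : Fact p.Prime] [Algebra (ZMod p) F]
    {S : Finset F[X]} (hirr : ∀ w ∈ S, w.Monic ∧ Irreducible w)
    (hclosed : ∀ w ∈ S, ∀ w' : F[X], w'.Monic → Irreducible w' → w'.natDegree = w.natDegree →
      w' ∈ S) {k : ℕ} (hk0 : 0 < k) (hk : (Fintype.card F - 1) ∣ k) :
    ∃ a b : (ZMod p)[X], aeval (polyBracket F ^ (Fintype.card F - 1)) b ≠ 0 ∧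
      ∑ w ∈ S, 1 / (1 - algebraMap F[X] (RatFunc F) w ^ k) =
        algebraMap F[X] (RatFunc F) (aeval (polyBracket F ^ (Fintype.card F - 1)) a) /
          algebraMap F[X] (RatFunc F) (aeval (polyBracket F ^ (Fintype.card F - 1)) b) := by
  obtain ⟨hne, hsum⟩ := sum_one_div_eq_div hk0 fun w hw => (hirr w hw).2
  have key : ∀ σ : F[X] ≃+* F[X], (∀ f, (σ f).natDegree = f.natDegree) →
      (powPoly S k).map (σ : F[X] →+* F[X]) = powPoly S k :=
    fun σ hσ => map_powPoly hirr hclosed hk σ hσ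
  obtain ⟨a, ha⟩ := exists_aeval_eq_of_map_eq p (f := (derivative (powPoly S k)).eval 1) (by
    intro σ hσ
    have h := eval_map_apply (p := derivative (powPoly S k)) (σ : F[X] →+* F[X]) 1
    rw [← derivative_map, key σ hσ, map_one] at h
    exact h.symm)
  obtain ⟨b, hb⟩ := exists_aeval_eq_of_map_eq p (f := (powPoly S k).eval 1) (by
    intro σ hσ
    have h := eval_map_apply (p := powPoly S k) (σ : F[X] →+* F[X]) 1
    rw [key σ hσ, map_one] at h
    exact h.symm)
  exact ⟨a, b, hb ▸ hne, by rw [hsum, ha, hb]⟩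

theorem dvd_of_vInfty_div_aeval_eq [Fintype F] (p : ℕ) [hp : Fact p.Prime] [Algebra (ZMod p) F]
    {a b : (ZMod p)[X]} (hb : aeval (polyBracket F ^ (Fintype.card F - 1)) b ≠ 0) {n : ℤ}
    (h : vInfty (algebraMap F[X] (RatFunc F) (aeval (polyBracket F ^ (Fintype.card F - 1)) a) /
      algebraMap F[X] (RatFunc F) (aeval (polyBracket F ^ (Fintype.card F - 1)) b)) = n) :
    (Fintype.card F : ℤ) * ((Fintype.card F : ℤ) - 1) ∣ n := by
  by_cases ha : aeval (polyBracket F ^ (Fintype.card F - 1)) a = 0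
  · simp [ha, vInfty] at h
  have hdeg : ∀ f : (ZMod p)[X], ((aeval (polyBracket F ^ (Fintype.card F - 1)) f).natDegree : ℤ) =
      (Fintype.card F : ℤ) * ((Fintype.card F : ℤ) - 1) * f.natDegree := by
    intro f
    rw [aeval_eq_map_comp, natDegree_comp, natDegree_pow, natDegree_polyBracket, natDegree_map]
    push_cast [Nat.cast_sub (Fintype.card_pos (α := F))]
    ring
  rw [vInfty_algebraMap_div ha hb, WithTop.coe_inj, hdeg, hdeg] at h
  exact ⟨(b.natDegree : ℤ) - a.natDegree, by rw [← h]; ring⟩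

theorem algebraMap_aeval_polyBracket_pow [Fintype F] (p : ℕ) [hp : Fact p.Prime]
    [Algebra (ZMod p) F] (a : (ZMod p)[X]) :
    algebraMap F[X] (RatFunc F) (aeval (polyBracket F ^ (Fintype.card F - 1)) a) =
      aeval (bracket F 1 ^ (Fintype.card F - 1)) a := by
  rw [← aeval_algebraMap_apply, map_pow]
  simp [polyBracket, bracket]

theorem bracket_pow_mem_adjoin [Fintype F] (p : ℕ) [hp : Fact p.Prime] [Algebra (ZMod p) F] :
    bracket F 1 ^ (Fintype.card F - 1) ∈
      (ZMod p)⟮((RatFunc.X : RatFunc F) ^ (Fintype.card F - 1))⟯ := by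
  have hX := IntermediateField.mem_adjoin_simple_self (ZMod p)
    ((RatFunc.X : RatFunc F) ^ (Fintype.card F - 1))
  have hb : bracket F 1 = RatFunc.X * (RatFunc.X ^ (Fintype.card F - 1) - 1) := by
    rw [bracket, mul_sub, ← pow_succ', Nat.sub_add_cancel Fintype.card_pos, mul_one, pow_one]
  rw [hb, mul_pow]
  exact mul_mem hX (pow_mem (sub_mem hX (one_mem _)) _)

theorem aeval_mem_intermediateField {K L : Type*} [Field K] [Field L] [Algebra K L]
    (E : IntermediateField K L) {x : L} (hx : x ∈ E) (f : K[X]) : aeval x f ∈ E := by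
  have := IntermediateField.aeval_coe E (R := K) ⟨x, hx⟩ f
  rw [this]
  exact SetLike.coe_mem _

end Symmetry

end PrimeSums

end

/-! ### Assembly of the assertions. -/

theorem mainTheorem3 (p q : ℕ) [Fact p.Prime] (F : Type*) [Field F] [Fintype F]
    [Algebra (ZMod p) F] (hq : Fintype.card F = q)
    (k d : ℕ) (hk : 0 < k) (hd : 0 < d) (hqk : (q - 1) ∣ k) :
    -- (0)
    (PrimeSums.PEq F d k ∈ (ZMod p)⟮((RatFunc.X : RatFunc F) ^ (q - 1))⟯ ∧
      ∃ a b : Polynomial (ZMod p),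
        Polynomial.aeval (PrimeSums.bracket F 1) b ≠ 0 ∧
        PrimeSums.PEq F d k =
          Polynomial.aeval (PrimeSums.bracket F 1) a /
            Polynomial.aeval (PrimeSums.bracket F 1) b) ∧
    -- (i), where the value `⊤` of the zero function counts as divisible
    ((∀ n : ℤ, PrimeSums.vInfty (PrimeSums.PEq F d k) = (n : WithTop ℤ) →
        (q : ℤ) * ((q : ℤ) - 1) ∣ n) ∧
      (((k : ℤ) * (d : ℤ) : ℤ) : WithTop ℤ) ≤ PrimeSums.vInfty (PrimeSums.PEq F d k) ∧
      (∀ n : ℤ, PrimeSums.vInfty (PrimeSums.PLE F d k) = (n : WithTop ℤ) →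
        (q : ℤ) * ((q : ℤ) - 1) ∣ n)) ∧
    -- (ii)
    (PrimeSums.vInfty (PrimeSums.PEq F d k) = (((k : ℤ) * (d : ℤ) : ℤ) : WithTop ℤ) ↔
      (q.Prime ∧ Squarefree d ∧ q ∣ d) ∨
        (q = 2 ∧ ∃ m : ℕ, Odd m ∧ Squarefree m ∧ d = 4 * m)) ∧
    -- (iii)
    (q = 2 → Odd k →
      (PrimeSums.coeffInfty (PrimeSums.PEq F d k) (-((d : ℤ) * (k : ℤ) + 1)) ≠ 0 ↔
        Squarefree d) ∧
      (Odd d → Squarefree d →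
        PrimeSums.vInfty (PrimeSums.PEq F d k) =
          (((d : ℤ) * (k : ℤ) + 1 : ℤ) : WithTop ℤ)) ∧
      ((Even d ∧ Squarefree d) ∨ (∃ m : ℕ, Odd m ∧ Squarefree m ∧ d = 4 * m) →
        PrimeSums.vInfty (PrimeSums.PEq F d k) = (((d : ℤ) * (k : ℤ) : ℤ) : WithTop ℤ)) ∧
      (¬ Squarefree d → (¬ ∃ m : ℕ, Odd m ∧ Squarefree m ∧ d = 4 * m) →
        (((d : ℤ) * (k : ℤ) + 1 : ℤ) : WithTop ℤ) <
          PrimeSums.vInfty (PrimeSums.PEq F d k))) := by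
  subst hq
  have hchar : CharP F p := charP_of_injective_algebraMap (algebraMap (ZMod p) F).injective p
  obtain ⟨a, b, hb, hP⟩ := PrimeSums.exists_sum_eq_div_aeval p (S := PrimeSums.primesEq F d)
    (fun w hw => ((PrimeSums.mem_primesEq F).1 hw).imp_right And.left)
    (fun w hw w' hm hi hd' => (PrimeSums.mem_primesEq F).2
      ⟨hm, hi, hd'.trans ((PrimeSums.mem_primesEq F).1 hw).2.2⟩) hk hqk
  obtain ⟨a', b', hb', hP'⟩ := PrimeSums.exists_sum_eq_div_aeval p
    (S := PrimeSums.primesLE F d)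
    (fun w hw => ((PrimeSums.mem_primesLE F).1 hw).imp_right And.left)
    (fun w hw w' hm hi hd' => (PrimeSums.mem_primesLE F).2
      ⟨hm, hi, hd'.trans_le ((PrimeSums.mem_primesLE F).1 hw).2.2⟩) hk hqk
  change PrimeSums.PEq F d k = _ at hP
  change PrimeSums.PLE F d k = _ at hP'
  have hexp := PrimeSums.expandInfty_PEq F hd hk
  have hkd : (k : ℤ) * d = (d * k : ℕ) := by push_cast; ring
  have hdk : (d : ℤ) * k = (d * k : ℕ) := by push_cast; ring
  have hii : PrimeSums.vInfty (PrimeSums.PEq F d k) = (((k : ℤ) * (d : ℤ) : ℤ) : WithTop ℤ) ↔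
      ((Fintype.card F).Prime ∧ Squarefree d ∧ Fintype.card F ∣ d) ∨
        (Fintype.card F = 2 ∧ ∃ m : ℕ, Odd m ∧ Squarefree m ∧ d = 4 * m) := by
    rw [PrimeSums.vInfty_eq_orderTop, hexp, hkd, PrimeSums.orderTop_ofPowerSeries_eq_iff,
      PrimeSums.coeff_zero_sum_unitPart F hd hk, neg_ne_zero, Ne, CharP.cast_eq_zero_iff F p,
      PrimeSums.not_dvd_card_primesEq_iff F p hd]
  refine ⟨⟨?_, ?_⟩, ⟨?_, ?_, ?_⟩, hii, ?_⟩
  · rw [hP, PrimeSums.algebraMap_aeval_polyBracket_pow, PrimeSums.algebraMap_aeval_polyBracket_pow]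
    exact div_mem
      (PrimeSums.aeval_mem_intermediateField _ (PrimeSums.bracket_pow_mem_adjoin p) a)
      (PrimeSums.aeval_mem_intermediateField _ (PrimeSums.bracket_pow_mem_adjoin p) b)
  -- Expanding by `q - 1` rewrites a polynomial in `[1] ^ (q - 1)` as one in `[1]`.
  · refine ⟨expand _ (Fintype.card F - 1) a, expand _ (Fintype.card F - 1) b, ?_, ?_⟩
    · rw [expand_aeval, ← PrimeSums.algebraMap_aeval_polyBracket_pow]
      exact (map_ne_zero_iff _ (RatFunc.algebraMap_injective F)).2 hb
    · rw [expand_aeval, expand_aeval, hP, PrimeSums.algebraMap_aeval_polyBracket_pow,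
        PrimeSums.algebraMap_aeval_polyBracket_pow]
  · intro n hn
    rw [hP] at hn
    exact PrimeSums.dvd_of_vInfty_div_aeval_eq p hb hn
  · rw [PrimeSums.vInfty_eq_orderTop, hexp, hkd]
    exact PrimeSums.le_orderTop_ofPowerSeries _ _
  · intro n hn
    rw [hP'] at hn
    exact PrimeSums.dvd_of_vInfty_div_aeval_eq p hb' hn
  · intro h2 hkodd
    have hone := PrimeSums.coeff_one_sum_unitPart_ne_zero_iff F h2 hd hkodd
    have hzero : PrimeSums.vInfty (PrimeSums.PEq F d k) ≠ (((k : ℤ) * (d : ℤ) : ℤ) : WithTop ℤ) →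
        PowerSeries.coeff 0 (∑ w ∈ PrimeSums.primesEq F d, -PrimeSums.unitPart w k) = 0 := by
      rw [PrimeSums.vInfty_eq_orderTop, hexp, hkd, Ne,
        PrimeSums.orderTop_ofPowerSeries_eq_iff, not_not]
      exact id
    refine ⟨?_, fun hodd hsq => ?_, fun h => ?_, fun hsq hnot => ?_⟩
    · rw [← hone, PrimeSums.coeffInfty, hexp, neg_neg, hdk]
      have := PrimeSums.coeff_ofPowerSeries_X_pow_mul_add (d * k) 1
        (∑ w ∈ PrimeSums.primesEq F d, -PrimeSums.unitPart w k)
      rw [Nat.cast_one] at this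
      rw [this]
    · have h0 := hzero (by
        rw [Ne, hii, h2]
        rintro (⟨-, -, h⟩ | ⟨-, m, -, -, rfl⟩)
        · exact hodd.not_two_dvd_nat h
        · exact hodd.not_two_dvd_nat ⟨2 * m, by ring⟩)
      rw [PrimeSums.vInfty_eq_orderTop, hexp, hdk,
        PrimeSums.orderTop_ofPowerSeries_eq_add_one_iff h0, hone]
      exact hsq
    · rw [mul_comm, hii, h2]
      rcases h with ⟨he, hsq⟩ | h
      · exact Or.inl ⟨Nat.prime_two, hsq, he.two_dvd⟩
      · exact Or.inr ⟨rfl, h⟩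
    · have h0 := hzero (by
        rw [Ne, hii]
        rintro (⟨-, h, -⟩ | ⟨-, h⟩)
        · exact hsq h
        · exact hnot h)
      rw [PrimeSums.vInfty_eq_orderTop, hexp, hdk]
      refine lt_of_le_of_ne (PrimeSums.add_one_le_orderTop_ofPowerSeries h0) fun h => hsq ?_
      exact hone.1 ((PrimeSums.orderTop_ofPowerSeries_eq_add_one_iff h0).1 h.symm)
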